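/- **Setting.** Let $x_{k+1}=f(x_k,u_k,w_k)$ with $x_k\in\mathbb R^n$, $u_k$ in a finite set $U$, and $w_k\in W\subseteq\mathbb R^d$ i.i.d. with unknown law $P$; each $f(\cdot,u,\cdot)$ is Borel. Let $X\subset\mathbb R^n$ be bounded and Borel, and suppose that for every $u\in U$ there is $L_u>0$ with $\|f(x,u,w)-f(x,u,w')\|\le L_u\|w-w'\|$ for all $x\in X$, $w,w'\in W$. Regions of interest $r\in R_{\mathrm{int}}$, $r\subseteq X$ Borel, and the unsafe region $\mathbb R^n\setminus X$ carry sets of atomic propositions from a finite set $AP$; the unsafe region carries (among others) $\mathfrak p_{\mathrm{unsafe}}$. $L(x)$ is the set of all propositions carried by the regions that contain $x$. A trajectory satisfies an LTL$_f$ formula if some nonempty prefix of its trace $L(x_0)L(x_1)\cdots$ does. Let $\varphi=\varphi'\wedge\Box\neg\mathfrak p_{\mathrm{unsafe}}$ with $\varphi'$ an LTL$_f$ formula, and let $\mathcal A^\varphi=(Z,2^{AP},\delta,z_0,Z_F)$ be a DFA that accepts a nonempty finite trace iff the trace satisfies $\varphi$. **Abstraction.** Let $J:\mathbb R^n\to S$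 be the quotient map of a finite Borel partition into nonempty regions that respects $X$ and $R_{\mathrm{int}}$, where $\mathbb R^n\setminus X=J^{-1}(s_u)$ is one region; let $L(s)$ be the common label of $J^{-1}(s)$, and $r_q:=J^{-1}(q)$ for $q\subseteq S$. Let $\hat w^{(1)},\dots,\hat w^{(N)}$, $N\ge1$, be i.i.d. samples from $P$, $\hat c=\max_i\|\hat w^{(i)}\|$, $\beta,\epsilon_c\in(0,1)$, $\beta_c>0$, $N\ge\log(1/\beta_c)/\log(1/(1-\epsilon_c))$ and $\epsilon=\sqrt{\log(2/\beta)/(2N)}$. With $\mathrm{Reach}(r,a,w)=\{f(x,a,w):x\in r\}$ put $$\underline P(r,a)(B)=\tfrac1N|\{i:\mathrm{Reach}(r,a,\hat w^{(i)})\subseteq B\}|-\epsilon,\qquad \overline P(r,a)(B)=\tfrac1N|\{i:\mathrm{Reach}(r,a,\hat w^{(i)})\cap B\ne\emptyset\}|+\epsilon .$$ Let $Q\subseteq 2^S$ be a clustering of $S$ into pairwise disjoint sets with union $S$. For $s\neq s_u$ and $a\in U$ let $Q(s,a)\subseteq Q$ be clusters whose union $C(s,a)$ contains every $J(f(x,a,w))$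 with $J(x)=s$, $\|w\|\le\hat c$; the choice depends on the data only through $\hat c$ and does not shrink when $\hat c$ grows (for example, the smallest such $Q(s,a)$). The UMDP $\mathcal M$ has states $S$, actions $U$, $\Gamma_{s_u,a}=\{\delta_{s_u}\}$ and, for $s\ne s_u$, $\Gamma_{s,a}$ is the set of probability distributions $\gamma$ on $S$ with $\underline P(r_s,a)(r_{s'})\le\gamma(s')\le\overline P(r_s,a)(r_{s'})$ for all $s'\in C(s,a)$, $\underline P(r_s,a)(r_q)\le\gamma(q)\le\overline P(r_s,a)(r_q)$ for all $q\in Q(s,a)$, and $\gamma(C(s,a))\ge1-\epsilon_c$. Put $$\hat\alpha=\beta_c+\Big(\sum_{s\ne s_u,\,a\in U}|C(s,a)|+|Q(s,a)|\Big)\beta .$$ **Synthesis.** The product $\mathcal M^\varphi=\mathcal M\otimes\mathcal A^\varphi$ has states $S\times Z$, actions $U$, accepting states $S\times Z_F$, and $\Gamma^\varphi_{(s,z),a}$ consists of the distributions $\gamma^\varphi$ for which there is $\gamma\in\Gamma_{s,a}$ with $\gamma^\varphi(s',\delta(z,L(s')))=\gamma(s')$ for all $s'$. Let $\underline p^\varphi=\lim_k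 p^k$, where $p^0=\mathbf 1_{S\times Z_F}$, $p^{k+1}=1$ on $S\times Z_F$, and $p^{k+1}(y)=\max_{a}\min_{\gamma\in\Gamma^\varphi_{y,a}}\sum_{y'}\gamma(y')p^k(y')$ elsewhere (robust dynamic programming). Let $\sigma^\varphi:S\times Z\to U$ be a memoryless strategy that is optimal, i.e. attains $\sup_\sigma\inf_\xi\Pr^{\sigma,\xi}_y[\text{reach }S\times Z_F]$ from every state $y$, where $\sigma$ ranges over all history-dependent strategies and $\xi$ over all adversaries that choose an element of $\Gamma^\varphi_{y,a}$ for every state $y$, action $a$ and time. Refine it to the strategy $\sigma_x$ of the system which, after a finite trajectory, plays $\sigma^\varphi(J(x_K),z)$, where $x_K$ is its last state and $z$ the state that $\mathcal A^\varphi$ has reached on its trace. **Theorem.** With confidence $1-\alpha$, $\alpha=\hat\alpha$, all sets $\Gamma_{s,a}$ are nonempty (so that $\mathcal M$ is a UMDP) and, for every such $\sigma^\varphi$ and all $x\in X$, $$P_x^{\sigma_x}[\text{the trajectory satisfies }\varphi]\ \ge\ \underline p^\varphi\big(J(x),\,\delta(z_0,L(J(x)))\big).$$ Precisely (since $\hat\alpha$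 may depend on the data through $\hat c$): for every number $\alpha$, the $P^N$-probability that $\hat\alpha\le\alpha$ and this assertion fails is at most $\alpha$; if $C(s,a)$ and $Q(s,a)$ do not depend on the data, this says that the assertion holds with $P^N$-probability at least $1-\hat\alpha$. -/

import Mathlib

open MeasureTheory ProbabilityTheory Filter Topology
open scoped ENNReal

/-! ### Linear temporal logic over finite traces -/

/-- Syntax of LTLf over the atomic propositions `AP`. -/
inductive LTLf (AP : Type*) where
  | tt : LTLf AP
  | atom : AP → LTLf AP
  | neg : LTLf AP → LTLf AP
  | conj : LTLf AP → LTLf AP → LTLf AP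
  | next : LTLf AP → LTLf AP
  | untl : LTLf AP → LTLf AP → LTLf AP

namespace LTLf

variable {AP : Type*}

/-- `◇ φ := ⊤ U φ`. -/
def eventually (φ : LTLf AP) : LTLf AP := untl tt φ

/-- `□ φ := ¬ ◇ ¬ φ`. -/
def globally (φ : LTLf AP) : LTLf AP := neg (eventually (neg φ))

/-- `SatAt ρ i φ`: the finite trace `ρ` satisfies `φ` at position `i`. -/
def SatAt (ρ : List (Set AP)) : ℕ → LTLf AP → Prop
  | _, tt => True
  | i, atom p => ∃ h : i < ρ.length, p ∈ ρ[i]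
  | i, neg φ => ¬ SatAt ρ i φ
  | i, conj φ ψ => SatAt ρ i φ ∧ SatAt ρ i ψ
  | i, next φ => i + 1 < ρ.length ∧ SatAt ρ (i + 1) φ
  | i, untl φ ψ => ∃ j, i ≤ j ∧ j < ρ.length ∧ SatAt ρ j ψ ∧
      ∀ k, i ≤ k → k < j → SatAt ρ k φ

/-- Satisfaction of a formula by a (nonempty) finite trace. -/
def Sat (ρ : List (Set AP)) (φ : LTLf AP) : Prop := SatAt ρ 0 φ

end LTLf

/-- The automaton `D` recognises the formula `φ`: a nonempty finite trace satisfies `φ` iff its run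
ends in an accepting state. -/
def DFA.Recognises {AP Z : Type*} (D : DFA (Set AP) Z) (φ : LTLf AP) : Prop :=
  ∀ ρ : List (Set AP), ρ ≠ [] → (D.eval ρ ∈ D.accept ↔ LTLf.Sat ρ φ)

/-! ### Finite paths -/

/-- Finite paths `x₀ -u₀→ x₁ -u₁→ ⋯ -u_{K-1}→ x_K` with states in `X` and actions in `A`. -/
inductive FinPath (X A : Type*) where
  | init : X → FinPath X A
  | step : FinPath X A → A → X → FinPath X A

namespace FinPath

variable {X A AP : Type*}

/-- The last state of a path. -/
def last : FinPath X A → X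
  | init x => x
  | step _ _ x => x

/-- The trace `L(x₀) L(x₁) ⋯ L(x_K)` of a path. -/
def trace (L : X → Set AP) : FinPath X A → List (Set AP)
  | init x => [L x]
  | step ω _ x => trace L ω ++ [L x]

/-- The path of length `k` that follows the state sequence `x` when the actions are the ones
selected by the strategy `σ`. -/
def ofStates (σ : FinPath X A → A) (x : ℕ → X) : ℕ → FinPath X A
  | 0 => init (x 0)
  | k + 1 => step (ofStates σ x k) (σ (ofStates σ x k)) (x (k + 1))

end FinPath

/-! ### The stochastic system `x_{k+1} = f (x_k, u_k, w_k)` -/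

section System

variable {X U V AP : Type*}

/-- The finite trajectories of the closed loop under the strategy `σ`, from the initial state `x`
and along the disturbance sequence `w`. -/
def sysPath (f : X → U → V → X) (σ : FinPath X U → U) (x : X) (w : ℕ → V) : ℕ → FinPath X U
  | 0 => .init x
  | k + 1 => .step (sysPath f σ x w k) (σ (sysPath f σ x w k))
      (f (sysPath f σ x w k).last (σ (sysPath f σ x w k)) (w k))

/-- The probability that the closed-loop trajectory from `x` under `σ` satisfies `φ`, i.e. that some
prefix of its trace satisfies `φ`; the disturbances are i.i.d. with law `P`. -/
noncomputable def satProb [MeasurableSpace V] (f : X → U → V → X) (P : Measure V)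
    (L : X → Set AP) (φ : LTLf AP) (σ : FinPath X U → U) (x : X) : ℝ≥0∞ :=
  Measure.infinitePi (fun _ : ℕ => P)
    {w | ∃ K : ℕ, LTLf.Sat ((sysPath f σ x w K).trace L) φ}

/-- The labelling of the continuous states: `x` carries the propositions associated (through `lab`)
to the regions of interest that contain it, and to the unsafe region `safeᶜ` if it lies there. -/
def labelOf (safe : Set X) (Rint : Set (Set X)) (lab : Set X → Set AP) (x : X) : Set AP :=
  {p | ∃ r ∈ insert safeᶜ Rint, x ∈ r ∧ p ∈ lab r}

end System

/-! ### Uncertain Markov decision processes -/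

/-- Transition structure of an uncertain MDP with states `S` and actions `A`. Nonemptiness of the
sets `Γ s a` is the separate predicate `WellPosed`, since for a data-driven `Γ` it depends on the
data; the initial state is an argument of the path measure. -/
structure UMDP (S A : Type*) where
  /-- the admissible transition distributions -/
  Γ : S → A → Set (PMF S)

namespace UMDP

variable {S A : Type*}

/-- All sets of transition distributions are nonempty. -/
def WellPosed (M : UMDP S A) : Prop := ∀ s a, (M.Γ s a).Nonempty

/-- Adversaries choose, for every state, action and time, an admissible distribution. -/
def Adversary (M : UMDP S A) : Type _ :=
  {ξ : S → A → ℕ → PMF S // ∀ s a k, ξ s a k ∈ M.Γ s a}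

variable [Finite S] [MeasurableSpace S] [MeasurableSingletonClass S]

/-- The law of the next state at time `k` given the states up to time `k`, under the strategy `σ`
and the adversary `ξ`. (The past actions are determined by the past states and `σ`.) -/
noncomputable def stepKernel (M : UMDP S A) (σ : FinPath S A → A) (ξ : M.Adversary) (k : ℕ) :
    Kernel (Π _ : Finset.Iic k, S) S :=
  Kernel.ofFunOfCountable fun h =>
    (ξ.1 (h ⟨k, Finset.mem_Iic.2 le_rfl⟩)
      (σ (FinPath.ofStates σ (fun i => h ⟨min i k, Finset.mem_Iic.2 (min_le_right i k)⟩) k))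
      k).toMeasure

instance (M : UMDP S A) (σ : FinPath S A → A) (ξ : M.Adversary) (k : ℕ) :
    IsMarkovKernel (M.stepKernel σ ξ k) :=
  ⟨fun _ => PMF.toMeasure.isProbabilityMeasure _⟩

/-- The law of the state sequence of the UMDP from `s` under the strategy `σ` and adversary `ξ`. -/
noncomputable def pathMeasure (M : UMDP S A) (σ : FinPath S A → A) (ξ : M.Adversary) (s : S) :
    Measure (ℕ → S) :=
  Kernel.traj (X := fun _ => S) (M.stepKernel σ ξ) 0 (fun _ => s)

/-- Worst-case probability, over all adversaries, of reaching `F` from `s` under `σ`. -/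
noncomputable def worstReach (M : UMDP S A) (F : Set S) (σ : FinPath S A → A) (s : S) : ℝ≥0∞ :=
  ⨅ ξ : M.Adversary, M.pathMeasure σ ξ s {ω | ∃ k, ω k ∈ F}

/-- The optimal robust reachability probability `sup_σ inf_ξ Pr(reach F)`. -/
noncomputable def optReach (M : UMDP S A) (F : Set S) (s : S) : ℝ≥0∞ :=
  ⨆ σ : FinPath S A → A, M.worstReach F σ s

/-- The memoryless strategy `σ` attains the optimal robust reachability probability of `F` from
every state. -/
def IsOptimal (M : UMDP S A) (F : Set S) (σ : S → A) : Prop :=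
  ∀ s, M.worstReach F (fun ω => σ ω.last) s = M.optReach F s

end UMDP

section RDP

variable {S A : Type*} [Fintype S]

open Classical in
/-- The robust dynamic programming recursion for reaching `F`. -/
noncomputable def UMDP.rdp (M : UMDP S A) (F : Set S) : ℕ → S → ℝ≥0∞
  | 0, s => if s ∈ F then 1 else 0
  | k + 1, s => if s ∈ F then 1 else ⨆ a : A, ⨅ γ ∈ M.Γ s a, ∑ s' : S, γ s' * M.rdp F k s'

/-- The lower value obtained by robust dynamic programming: the limit of the recursion (which is
nondecreasing, see `rdp_tendsto`). -/
noncomputable def UMDP.rdpValue (M : UMDP S A) (F : Set S) (s : S) : ℝ≥0∞ := ⨆ k, M.rdp F k s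

theorem UMDP.rdp_mono (M : UMDP S A) (F : Set S) : Monotone (M.rdp F) := by
  refine monotone_nat_of_le_succ fun k => ?_
  induction k with
  | zero =>
    intro s
    by_cases h : s ∈ F <;> simp [UMDP.rdp, h]
  | succ k ih =>
    intro s
    rw [UMDP.rdp, UMDP.rdp]
    split_ifs with h
    · exact le_rfl
    · exact iSup_mono fun a => iInf₂_mono fun γ _ =>
        Finset.sum_le_sum fun s' _ => mul_le_mul_right (ih s') _

theorem UMDP.rdp_tendsto (M : UMDP S A) (F : Set S) (s : S) :
    Tendsto (fun k => M.rdp F k s) atTop (𝓝 (M.rdpValue F s)) :=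
  tendsto_atTop_iSup fun _ _ h => M.rdp_mono F h s

end RDP

/-- The product of a UMDP with labelling `L` and a DFA. -/
def UMDP.product {S A AP Z : Type*} (M : UMDP S A) (L : S → Set AP) (D : DFA (Set AP) Z) :
    UMDP (S × Z) A where
  Γ sz a := {γφ | ∃ γ ∈ M.Γ sz.1 a, ∀ s', γφ (s', D.step sz.2 (L s')) = γ s'}

/-- The accepting states `S × Z_F` of the product. -/
def acceptingStates (S : Type*) {AP Z : Type*} (D : DFA (Set AP) Z) : Set (S × Z) :=
  {sz | sz.2 ∈ D.accept}

/-! ### The data-driven abstraction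

Below, `J : X → S` maps each continuous state to the abstract state of its region, so that the
region of `s` is `J ⁻¹' {s}` and the region of a cluster `q` is `J ⁻¹' q`. -/

section Abstraction

variable {X U V S AP : Type*}

/-- The propositions that hold on the region of an abstract state. -/
def absLabel (J : X → S) (L : X → Set AP) (s : S) : Set AP := {p | ∀ x, J x = s → p ∈ L x}

/-- Reachable set of the region `r` under the action `a` and the disturbance `w`. -/
def reach (f : X → U → V → X) (r : Set X) (a : U) (w : V) : Set X := (fun x => f x a w) '' r

/-- `ε = √(log (2 / β) / (2 N))`. -/
noncomputable def hoeffdingEps (N : ℕ) (β : ℝ) : ℝ := √(Real.log (2 / β) / (2 * N))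

/-- Data-driven lower bound on the probability of moving from `r` into `B` under `a`. -/
noncomputable def lowerP {N : ℕ} (f : X → U → V → X) (β : ℝ) (ŵ : Fin N → V) (r : Set X) (a : U)
    (B : Set X) : ℝ :=
  ({i | reach f r a (ŵ i) ⊆ B}.ncard : ℝ) / N - hoeffdingEps N β

/-- Data-driven upper bound on the probability of moving from `r` into `B` under `a`. -/
noncomputable def upperP {N : ℕ} (f : X → U → V → X) (β : ℝ) (ŵ : Fin N → V) (r : Set X) (a : U)
    (B : Set X) : ℝ :=
  ({i | (reach f r a (ŵ i) ∩ B).Nonempty}.ncard : ℝ) / N + hoeffdingEps N β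

/-- The radius `ĉ = max_i ‖ŵ i‖` of the learned support. -/
noncomputable def radius {N d : ℕ} {W : Set (EuclideanSpace ℝ (Fin d))} (ŵ : Fin N → W) : ℝ :=
  ⨆ i, ‖(ŵ i : EuclideanSpace ℝ (Fin d))‖

/-- Abstract states that can be reached from the region of `s` under `a` and some disturbance of
norm at most `c`. -/
def post {d : ℕ} {W : Set (EuclideanSpace ℝ (Fin d))} (f : X → U → W → X) (J : X → S) (c : ℝ)
    (s : S) (a : U) : Set S :=
  {s' | ∃ (x : X) (w : W), J x = s ∧ ‖(w : EuclideanSpace ℝ (Fin d))‖ ≤ c ∧ J (f x a w) = s'}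

variable [DecidableEq S]

/-- The UMDP abstraction: `su` is the (absorbing) unsafe state, `Qsa s a` the selected clusters, and
`C(s,a)` their union `(Qsa s a).biUnion id`. -/
noncomputable def abstraction {N : ℕ} (f : X → U → V → X) (J : X → S) (su : S) (β εc : ℝ)
    (ŵ : Fin N → V) (Qsa : S → U → Finset (Finset S)) : UMDP S U where
  Γ s a :=
    if s = su then {PMF.pure su}
    else {γ | (∀ s' ∈ (Qsa s a).biUnion id,
                lowerP f β ŵ (J ⁻¹' {s}) a (J ⁻¹' {s'}) ≤ (γ s').toReal ∧
                (γ s').toReal ≤ upperP f β ŵ (J ⁻¹' {s}) a (J ⁻¹' {s'})) ∧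
              (∀ q ∈ Qsa s a,
                lowerP f β ŵ (J ⁻¹' {s}) a (J ⁻¹' (q : Set S)) ≤ ∑ s' ∈ q, (γ s').toReal ∧
                ∑ s' ∈ q, (γ s').toReal ≤ upperP f β ŵ (J ⁻¹' {s}) a (J ⁻¹' (q : Set S))) ∧
              1 - εc ≤ ∑ s' ∈ (Qsa s a).biUnion id, (γ s').toReal}

/-- The confidence loss `βc + (∑_{s ≠ su, a} (|C(s,a)| + |Q(s,a)|)) β` of the abstraction. -/
noncomputable def confidenceLoss [Fintype S] [Fintype U] (su : S) (β βc : ℝ)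
    (Qsa : S → U → Finset (Finset S)) : ℝ :=
  βc + (∑ s ∈ Finset.univ.erase su, ∑ a : U,
    ((((Qsa s a).biUnion id).card : ℝ) + ((Qsa s a).card : ℝ))) * β

end Abstraction

/-- Refinement of a memoryless strategy of the product UMDP to a strategy of the system: after a
finite trajectory, play the action chosen in the abstract state of its last state and the state that
the DFA has reached on its trace. -/
def refineStrategy {X U S AP Z : Type*} (J : X → S) (L : X → Set AP) (D : DFA (Set AP) Z)
    (σ : S × Z → U) : FinPath X U → U :=
  fun ω => σ (J ω.last, D.eval (ω.trace L))

/-!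
The proof has a statistical, a dynamic programming and a coupling part.

*Statistics.* For a fixed region, action and target set, the interval bounds hold at all points of
the region simultaneously except with probability `β`. This is Hoeffding's inequality for the
frequency of the event that the whole region is sent into the target
(`measure_pi_boundsFail_le`), where the possibly non-measurable event is replaced by its measurable
hull. The learned support has probability at least `1 - εc` except with probability `βc`
(`measure_pi_radius_lt_le`). The selection of clusters depends on the data only through the radius
and monotonically, so the selections of confidence loss at most `α` form a finite chain with a
largest element (`exists_largest_selection`), and one union bound over that fixed selection covers
all of them (`measure_pi_abstraction_fails_le`). Outside this exceptional event the true transition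
law from every safe continuous state belongs to the sets `Γ` of the abstraction
(`lawPMF_mem_abstraction`), which are therefore nonempty.

*Robust values.* Robust dynamic programming is a lower bound for the optimal robust reachability
probability (`UMDP.rdpValue_le_optReach`). Conversely, the worst case of a memoryless strategy over
the time-dependent adversaries is at most the limit of the recursion that evaluates this strategy
(`UMDP.worstReach_le_rdpValue_induced`). Both are (super)martingale arguments for the value process
stopped at the target. So for an optimal strategy the evaluating recursion has at least the value of
robust dynamic programming (`UMDP.IsOptimal.rdpValue_le`).

*Coupling.* The pair of continuous state and automaton state is a Markov chain under the refined
strategy. By induction on the horizon, the evaluating recursion bounds from below the probability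
that the automaton accepts (`rdpValue_induced_le_satProb`). The true transition law depends on the
continuous state and not only on its region, so it is not itself played by an adversary of the
product; but the recursion minimises over all of `Γ` at every step, hence is below the expectation
under each such law. In the unsafe region, where the abstraction is absorbing and the system is not,
the automaton can no longer accept and the robust value is zero.
-/

/-! ### Finite-sample bounds -/

/-- One-sided Hoeffding bound for the empirical frequency of an event in an i.i.d. sample. -/
theorem measure_pi_frequency_gt_le {V : Type*} [MeasurableSpace V] (P : Measure V)
    [IsProbabilityMeasure P] {N : ℕ} (hN : 0 < N) {A : Set V} (hA : MeasurableSet A)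
    {ε : ℝ} (hε : 0 ≤ ε) :
    Measure.pi (fun _ : Fin N => P) {ŵ | P.real A + ε < ({i | ŵ i ∈ A}.ncard : ℝ) / N}
      ≤ ENNReal.ofReal (Real.exp (-(2 * N * ε ^ 2))) := by
  classical
  have hN' : (0 : ℝ) < N := by exact_mod_cast hN
  set g : V → ℝ := A.indicator 1 with hg
  have hgm : Measurable g := measurable_one.indicator hA
  have hgi : P[g] = P.real A := by simp [hg, integral_indicator_one hA]
  have hsub : HasSubgaussianMGF (fun v => g v - P.real A) ((‖(1 : ℝ) - 0‖₊ / 2) ^ 2) P := by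
    rw [← hgi]
    refine hasSubgaussianMGF_of_mem_Icc hgm.aemeasurable (ae_of_all _ fun v => ?_)
    by_cases hv : v ∈ A <;> simp [hg, hv]
  have hind : iIndepFun (fun (i : Fin N) (ŵ : Fin N → V) => g (ŵ i) - P.real A)
      (Measure.pi fun _ => P) :=
    iIndepFun_pi (X := fun _ v => g v - P.real A) fun i => (hgm.sub_const _).aemeasurable
  have hsub' : ∀ i ∈ (Finset.univ : Finset (Fin N)),
      HasSubgaussianMGF (fun ŵ : Fin N → V => g (ŵ i) - P.real A) ((‖(1 : ℝ) - 0‖₊ / 2) ^ 2)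
        (Measure.pi fun _ => P) := fun i _ => by
    have h : HasSubgaussianMGF (fun v => g v - P.real A) ((‖(1 : ℝ) - 0‖₊ / 2) ^ 2)
        ((Measure.pi fun _ : Fin N => P).map (Function.eval i)) := by
      rwa [(measurePreserving_eval (fun _ : Fin N => P) i).map_eq]
    exact h.of_map (measurePreserving_eval (fun _ : Fin N => P) i).measurable.aemeasurable
  have key := HasSubgaussianMGF.measure_sum_ge_le_of_iIndepFun hind hsub'
    (mul_nonneg hN'.le hε)
  refine (measure_mono ?_).trans
    ((ENNReal.le_ofReal_iff_toReal_le (measure_ne_top _ _) (Real.exp_pos _).le).2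
      (key.trans (Real.exp_le_exp.2 ?_)))
  · intro ŵ hw
    have hcard : ({i | ŵ i ∈ A}.ncard : ℝ) = ∑ i, g (ŵ i) := by
      rw [Set.ncard_eq_toFinset_card']
      simp [hg, Set.indicator_apply, Finset.sum_boole]
    simp only [Set.mem_ofPred_eq] at hw ⊢
    rw [lt_div_iff₀ hN', hcard] at hw
    simp only [Finset.sum_sub_distrib, Finset.sum_const, Finset.card_univ, Fintype.card_fin,
      nsmul_eq_mul]
    nlinarith
  · simp
    apply le_of_eq
    field_simp

theorem exp_neg_hoeffdingEps {N : ℕ} (hN : 0 < N) {β : ℝ} (hβ : β ∈ Set.Ioo (0 : ℝ) 1) :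
    Real.exp (-(2 * N * hoeffdingEps N β ^ 2)) = β / 2 := by
  have hN' : (0 : ℝ) < N := by exact_mod_cast hN
  have h2 : 1 < 2 / β := by rw [lt_div_iff₀ hβ.1]; linarith [hβ.2]
  rw [hoeffdingEps, Real.sq_sqrt (div_nonneg (Real.log_pos h2).le (by positivity)),
    mul_div_cancel₀ _ (by positivity), Real.exp_neg, Real.exp_log (by linarith), inv_div]

theorem upperP_eq_one_sub_lowerP_compl {X U V : Type*} {N : ℕ} (hN : 0 < N) (f : X → U → V → X)
    (β : ℝ) (ŵ : Fin N → V) (r : Set X) (a : U) (B : Set X) :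
    upperP f β ŵ r a B = 1 - lowerP f β ŵ r a Bᶜ := by
  have hN' : (N : ℝ) ≠ 0 := by exact_mod_cast hN.ne'
  have h : {i | (reach f r a (ŵ i) ∩ B).Nonempty} = {i | reach f r a (ŵ i) ⊆ Bᶜ}ᶜ := by
    ext i
    simp [Set.subset_compl_iff_disjoint_right, Set.not_disjoint_iff_nonempty_inter]
  have h2 := Set.ncard_add_ncard_compl {i | reach f r a (ŵ i) ⊆ Bᶜ}
  rw [Nat.card_fin] at h2
  have h3 : ({i | reach f r a (ŵ i) ⊆ Bᶜ}.ncard : ℝ) + ({i | reach f r a (ŵ i) ⊆ Bᶜ}ᶜ.ncard : ℝ)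
      = N := by exact_mod_cast h2
  rw [upperP, lowerP, h, eq_sub_of_add_eq' h3]
  field_simp
  ring

section Bounds

variable {X U V : Type*} [MeasurableSpace V]

/-- The sampled lower bound is valid at every point of the region `r` simultaneously. The set of
disturbances that take all of `r` into `B` need not be measurable; its measurable hull has the same
outer measure, which is below each of the transition probabilities. -/
theorem measure_pi_lowerP_gt_le (P : Measure V) [IsProbabilityMeasure P] {N : ℕ} (hN : 0 < N)
    (f : X → U → V → X) (a : U) {β : ℝ} (hβ : β ∈ Set.Ioo (0 : ℝ) 1) (r B : Set X) :
    Measure.pi (fun _ : Fin N => P)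
      {ŵ | ∃ x ∈ r, P.real {w | f x a w ∈ B} < lowerP f β ŵ r a B} ≤ ENNReal.ofReal (β / 2) := by
  set A : Set V := {w | reach f r a w ⊆ B}
  rw [← exp_neg_hoeffdingEps hN hβ]
  refine (measure_mono ?_).trans
    (measure_pi_frequency_gt_le P hN (measurableSet_toMeasurable P A)
      (ε := hoeffdingEps N β) (Real.sqrt_nonneg _))
  rintro ŵ ⟨x, hx, hlt⟩
  have h1 : P.real (toMeasurable P A) ≤ P.real {w | f x a w ∈ B} := by
    rw [measureReal_def, measure_toMeasurable]
    exact measureReal_mono fun w hw => hw ⟨x, hx, rfl⟩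
  have h2 : ({i | reach f r a (ŵ i) ⊆ B}.ncard : ℝ) / N
      ≤ ({i | ŵ i ∈ toMeasurable P A}.ncard : ℝ) / N := by
    gcongr
    · exact Set.toFinite _
    · rename_i i
      exact fun hi => subset_toMeasurable P A hi
  simp only [lowerP, Set.mem_ofPred_eq] at hlt ⊢
  linarith

theorem measure_pi_upperP_lt_le [MeasurableSpace X] (P : Measure V) [IsProbabilityMeasure P]
    {N : ℕ} (hN : 0 < N)
    (f : X → U → V → X) (a : U) (hf : ∀ x, Measurable (f x a)) {β : ℝ}
    (hβ : β ∈ Set.Ioo (0 : ℝ) 1) (r : Set X) {B : Set X} (hB : MeasurableSet B) :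
    Measure.pi (fun _ : Fin N => P)
      {ŵ | ∃ x ∈ r, upperP f β ŵ r a B < P.real {w | f x a w ∈ B}} ≤ ENNReal.ofReal (β / 2) := by
  refine (measure_mono ?_).trans (measure_pi_lowerP_gt_le P hN f a hβ r Bᶜ)
  rintro ŵ ⟨x, hx, hlt⟩
  refine ⟨x, hx, ?_⟩
  have h : P.real {w | f x a w ∈ Bᶜ} = 1 - P.real {w | f x a w ∈ B} :=
    probReal_compl_eq_one_sub (hf x hB)
  rw [upperP_eq_one_sub_lowerP_compl hN] at hlt
  linarith

/-- The samples for which the bounds on the probability of moving from `r` into `B` are wrong at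
some point of `r`. -/
def boundsFail {N : ℕ} (P : Measure V) (f : X → U → V → X) (β : ℝ) (r : Set X) (a : U)
    (B : Set X) : Set (Fin N → V) :=
  {ŵ | ∃ x ∈ r, P.real {w | f x a w ∈ B} < lowerP f β ŵ r a B} ∪
    {ŵ | ∃ x ∈ r, upperP f β ŵ r a B < P.real {w | f x a w ∈ B}}

theorem measure_pi_boundsFail_le [MeasurableSpace X] (P : Measure V) [IsProbabilityMeasure P]
    {N : ℕ} (hN : 0 < N)
    (f : X → U → V → X) (a : U) (hf : ∀ x, Measurable (f x a)) {β : ℝ}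
    (hβ : β ∈ Set.Ioo (0 : ℝ) 1) (r : Set X) {B : Set X} (hB : MeasurableSet B) :
    Measure.pi (fun _ : Fin N => P) (boundsFail P f β r a B) ≤ ENNReal.ofReal β := by
  refine (measure_union_le _ _).trans ((add_le_add (measure_pi_lowerP_gt_le P hN f a hβ r B)
    (measure_pi_upperP_lt_le P hN f a hf hβ r hB)).trans_eq ?_)
  rw [← ENNReal.ofReal_add (by linarith [hβ.1]) (by linarith [hβ.1]), add_halves]

end Bounds

theorem one_sub_pow_le_of_log_div_log_le {N : ℕ} {εc βc : ℝ} (hεc : εc ∈ Set.Ioo (0 : ℝ) 1)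
    (hβc : 0 < βc) (hNc : Real.log (1 / βc) / Real.log (1 / (1 - εc)) ≤ N) :
    (1 - εc) ^ N ≤ βc := by
  have h1 : 0 < 1 - εc := by linarith [hεc.2]
  have hpos : 0 < Real.log (1 / (1 - εc)) :=
    Real.log_pos (by rw [lt_div_iff₀ h1]; linarith [hεc.1])
  rw [div_le_iff₀ hpos] at hNc
  simp only [one_div, Real.log_inv] at hNc
  rw [← Real.log_le_log_iff (by positivity) hβc, Real.log_pow]
  linarith

/-- If all sublevel sets of `g` with levels in a lower set `G` have measure at most `p`, then so has
their union. -/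
theorem measure_preimage_lowerSet_le {V : Type*} [MeasurableSpace V] (P : Measure V) (g : V → ℝ)
    {G : Set ℝ} (hG : IsLowerSet G) {p : ℝ≥0∞} (hp : ∀ c ∈ G, P {w | g w ≤ c} ≤ p) :
    P {w | g w ∈ G} ≤ p := by
  by_cases hmax : ∃ a ∈ G, ∀ c ∈ G, c ≤ a
  · obtain ⟨a, ha, hmax⟩ := hmax
    exact (measure_mono fun w (hw : g w ∈ G) => (hmax _ hw : g w ≤ a)).trans (hp a ha)
  push Not at hmax
  have hsub : {w | g w ∈ G} ⊆ ⋃ q ∈ {q : ℚ | (q : ℝ) ∈ G}, {w | g w ≤ q} := by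
    intro w hw
    obtain ⟨c, hc, hlt⟩ := hmax _ hw
    obtain ⟨q, hq1, hq2⟩ := exists_rat_btwn hlt
    exact Set.mem_biUnion (hG hq2.le hc : (q : ℝ) ∈ G) hq1.le
  refine (measure_mono hsub).trans ?_
  rw [measure_biUnion_eq_iSup (Set.to_countable _)]
  · exact iSup₂_le fun q hq => hp q hq
  · intro q hq q' hq'
    refine ⟨max q q', ?_, fun w (hw : g w ≤ q) => ?_, fun w (hw : g w ≤ q') => ?_⟩
    · rcases max_choice q q' with h | h <;> rw [h] <;> assumption
    · exact hw.trans (by exact_mod_cast le_max_left q q')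
    · exact hw.trans (by exact_mod_cast le_max_right q q')

/-- With confidence `1 - βc`, a fresh disturbance lies in the learned support with probability at
least `1 - εc`. -/
theorem measure_pi_radius_lt_le {N d : ℕ} {W : Set (EuclideanSpace ℝ (Fin d))} (P : Measure W)
    [IsProbabilityMeasure P] {εc βc : ℝ} (hεc : εc ∈ Set.Ioo (0 : ℝ) 1)
    (hβc : 0 < βc) (hNc : Real.log (1 / βc) / Real.log (1 / (1 - εc)) ≤ N) :
    Measure.pi (fun _ : Fin N => P)
      {ŵ | P.real {w | ‖(w : EuclideanSpace ℝ (Fin d))‖ ≤ radius ŵ} < 1 - εc}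
      ≤ ENNReal.ofReal βc := by
  set G : Set ℝ := {c | P.real {w : W | ‖(w : EuclideanSpace ℝ (Fin d))‖ ≤ c} < 1 - εc} with hGdef
  have hG : IsLowerSet G := fun c c' hcc hc =>
    (measureReal_mono fun w (hw : _ ≤ c') => hw.trans hcc).trans_lt hc
  have hGp : ∀ c ∈ G, P {w : W | ‖(w : EuclideanSpace ℝ (Fin d))‖ ≤ c} ≤ ENNReal.ofReal (1 - εc) :=
    fun c hc => (ENNReal.le_ofReal_iff_toReal_le (measure_ne_top _ _) (by linarith [hεc.2])).2
      (le_of_lt hc)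
  have hT := measure_preimage_lowerSet_le P (fun w : W => ‖(w : EuclideanSpace ℝ (Fin d))‖) hG hGp
  set T : Set W := {w | ‖(w : EuclideanSpace ℝ (Fin d))‖ ∈ G}
  calc _ ≤ Measure.pi (fun _ : Fin N => P) (Set.univ.pi fun _ => T) := by
        refine measure_mono fun ŵ hw i _ => ?_
        exact hG (le_ciSup (f := fun i => ‖(ŵ i : EuclideanSpace ℝ (Fin d))‖)
          (Set.finite_range _).bddAbove i) hw
    _ = P T ^ N := by simp [Measure.pi_pi]
    _ ≤ ENNReal.ofReal (1 - εc) ^ N := by gcongr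
    _ = ENNReal.ofReal ((1 - εc) ^ N) := (ENNReal.ofReal_pow (by linarith [hεc.2]) _).symm
    _ ≤ ENNReal.ofReal βc :=
        ENNReal.ofReal_le_ofReal (one_sub_pow_le_of_log_div_log_le hεc hβc hNc)

/-! ### Path measures under Markov strategies -/

namespace FinPath

variable {X A : Type*}

/-- The number of transitions of a path. -/
def length : FinPath X A → ℕ
  | init _ => 0
  | step ω _ _ => length ω + 1

/-- The strategy that plays `π k s` in the state `s` at time `k`. -/
def markovStrategy (π : ℕ → X → A) : FinPath X A → A := fun ω => π ω.length ω.last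

theorem length_ofStates (σ : FinPath X A → A) (x : ℕ → X) (k : ℕ) :
    (ofStates σ x k).length = k := by
  induction k with
  | zero => rfl
  | succ k ih => simp [ofStates, length, ih]

theorem last_ofStates (σ : FinPath X A → A) (x : ℕ → X) (k : ℕ) :
    (ofStates σ x k).last = x k := by
  cases k <;> rfl

end FinPath

theorem lintegral_traj_succ {S : Type*} [MeasurableSpace S]
    (κ : (k : ℕ) → Kernel (Π _ : Finset.Iic k, S) S) [∀ k, IsMarkovKernel (κ k)]
    (x₀ : Π _ : Finset.Iic 0, S) (b : ℕ) {g : (Π _ : Finset.Iic b, S) → S → ℝ≥0∞}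
    (hg : Measurable (Function.uncurry g)) :
    ∫⁻ ω, g (Preorder.frestrictLe b ω) (ω (b + 1)) ∂Kernel.traj (X := fun _ => S) κ 0 x₀ =
      ∫⁻ ω, ∫⁻ s', g (Preorder.frestrictLe b ω) s' ∂κ b (Preorder.frestrictLe b ω)
        ∂Kernel.traj (X := fun _ => S) κ 0 x₀ := by
  have h1 := Kernel.partialTraj_compProd_eq_map_traj (X := fun _ => S) (κ := κ) (a := 0) (b := b)
    (Nat.zero_le b) (x₀ := x₀)
  have h2 : ∫⁻ p, Function.uncurry g p ∂((Kernel.partialTraj (X := fun _ => S) κ 0 b x₀) ⊗ₘ (κ b)) =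
      ∫⁻ h, ∫⁻ s', g h s' ∂κ b h ∂(Kernel.partialTraj (X := fun _ => S) κ 0 b x₀) :=
    Measure.lintegral_compProd hg
  rw [h1, lintegral_map hg (by fun_prop), ← Kernel.traj_map_frestrictLe_apply,
    lintegral_map hg.lintegral_kernel_prod_right (by fun_prop)] at h2
  exact h2

namespace UMDP

variable {S A : Type*} [Fintype S] [MeasurableSpace S] [MeasurableSingletonClass S]

instance (M : UMDP S A) (σ : FinPath S A → A) (ξ : M.Adversary) (s : S) :
    IsProbabilityMeasure (M.pathMeasure σ ξ s) := by
  unfold pathMeasure; infer_instance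

theorem lintegral_toMeasure (p : PMF S) (g : S → ℝ≥0∞) :
    ∫⁻ s, g s ∂p.toMeasure = ∑ s, p s * g s := by
  rw [lintegral_fintype]
  exact Finset.sum_congr rfl fun s _ => by
    rw [p.toMeasure_apply_singleton s (measurableSet_singleton s), mul_comm]

theorem lintegral_pathMeasure_succ (M : UMDP S A) (π : ℕ → S → A) (ξ : M.Adversary) (s : S) (b : ℕ)
    (g : (Π _ : Finset.Iic b, S) → S → ℝ≥0∞) :
    ∫⁻ ω, g (Preorder.frestrictLe b ω) (ω (b + 1)) ∂M.pathMeasure (FinPath.markovStrategy π) ξ s =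
      ∫⁻ ω, ∑ s', ξ.1 (ω b) (π b (ω b)) b s' * g (Preorder.frestrictLe b ω) s'
        ∂M.pathMeasure (FinPath.markovStrategy π) ξ s := by
  rw [pathMeasure, lintegral_traj_succ _ _ _ (measurable_of_finite (Function.uncurry g))]
  refine lintegral_congr fun ω => ?_
  rw [← lintegral_toMeasure]
  simp [stepKernel, Kernel.ofFunOfCountable, FinPath.markovStrategy, FinPath.length_ofStates,
    FinPath.last_ofStates]

theorem lintegral_pathMeasure_zero (M : UMDP S A) (σ : FinPath S A → A) (ξ : M.Adversary) (s : S)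
    (g : S → ℝ≥0∞) : ∫⁻ ω, g (ω 0) ∂M.pathMeasure σ ξ s = g s := by
  have h : Measurable fun ω : ℕ → S => g (ω 0) :=
    (measurable_of_finite g).comp (measurable_pi_apply 0)
  rw [pathMeasure, Kernel.lintegral_traj _ h]
  simp [Function.updateFinset]

/-! ### Robust values and worst-case reachability -/

open Classical in
/-- The value process `V k (ω k)`, stopped with value `1` when `F` is first visited. -/
noncomputable def stopped (F : Set S) (V : ℕ → S → ℝ≥0∞) (k : ℕ) (ω : ℕ → S) : ℝ≥0∞ :=
  if ∃ i ≤ k, ω i ∈ F then 1 else V k (ω k)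

theorem lintegral_stopped_zero (M : UMDP S A) (σ : FinPath S A → A) (ξ : M.Adversary) (s : S)
    {F : Set S} {V : ℕ → S → ℝ≥0∞} (hV : ∀ y ∈ F, V 0 y = 1) :
    ∫⁻ ω, stopped F V 0 ω ∂M.pathMeasure σ ξ s = V 0 s := by
  rw [← lintegral_pathMeasure_zero M σ ξ s (V 0)]
  refine lintegral_congr fun ω => ?_
  simp only [stopped]
  split_ifs with h
  · obtain ⟨i, hi, h⟩ := h
    obtain rfl := Nat.le_zero.1 hi
    exact (hV _ h).symm
  · rfl

open Classical in
theorem lintegral_stopped_succ (M : UMDP S A) (π : ℕ → S → A) (ξ : M.Adversary) (s : S) (b : ℕ)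
    {F : Set S} {V : ℕ → S → ℝ≥0∞} (hV : ∀ y ∈ F, V (b + 1) y = 1) :
    ∫⁻ ω, stopped F V (b + 1) ω ∂M.pathMeasure (FinPath.markovStrategy π) ξ s =
      ∫⁻ ω, (if ∃ i ≤ b, ω i ∈ F then 1
        else ∑ s', ξ.1 (ω b) (π b (ω b)) b s' * V (b + 1) s')
        ∂M.pathMeasure (FinPath.markovStrategy π) ξ s := by
  set g : (Π _ : Finset.Iic b, S) → S → ℝ≥0∞ :=
    fun h s' => if ∃ i : Finset.Iic b, h i ∈ F then 1 else V (b + 1) s' with hg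
  have hex : ∀ ω : ℕ → S, (∃ i : Finset.Iic b, Preorder.frestrictLe b ω i ∈ F) ↔
      ∃ i ≤ b, ω i ∈ F := by simp
  have h1 : ∀ ω : ℕ → S, stopped F V (b + 1) ω = g (Preorder.frestrictLe b ω) (ω (b + 1)) := by
    intro ω
    simp only [stopped, hg, hex, Nat.le_succ_iff]
    by_cases h : ∃ i ≤ b, ω i ∈ F
    · obtain ⟨i, hi, hF⟩ := h
      rw [if_pos ⟨i, Or.inl hi, hF⟩, if_pos ⟨i, hi, hF⟩]
    · rw [if_neg h]
      split_ifs with h'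
      · obtain ⟨i, hi | rfl, hF⟩ := h'
        · exact absurd ⟨i, hi, hF⟩ h
        · exact (hV _ hF).symm
      · rfl
  simp_rw [h1]
  rw [lintegral_pathMeasure_succ]
  refine lintegral_congr fun ω => ?_
  simp only [hg, hex]
  split_ifs
  · rw [← lintegral_toMeasure]; simp
  · rfl

omit [Fintype S] in
theorem measurableSet_visited [Finite S] (F : Set S) (k : ℕ) :
    MeasurableSet {ω : ℕ → S | ∃ i ≤ k, ω i ∈ F} := by
  have : {ω : ℕ → S | ∃ i ≤ k, ω i ∈ F} = ⋃ i ∈ Set.Iic k, (fun ω : ℕ → S => ω i) ⁻¹' F := by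
    ext; simp
  rw [this]
  exact .biUnion (Set.to_countable _) fun i _ => measurable_pi_apply i (Set.toFinite F).measurableSet

omit [Fintype S] in
theorem measure_visited_le_lintegral_stopped [Finite S] (μ : Measure (ℕ → S)) (F : Set S)
    (V : ℕ → S → ℝ≥0∞) (k : ℕ) :
    μ {ω | ∃ i ≤ k, ω i ∈ F} ≤ ∫⁻ ω, stopped F V k ω ∂μ := by
  rw [← lintegral_indicator_one (measurableSet_visited F k)]
  refine lintegral_mono fun ω => ?_
  by_cases h : ∃ i ≤ k, ω i ∈ F
  · rw [stopped, if_pos h, Set.indicator_of_mem (by exact h)]; rfl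
  · rw [Set.indicator_of_notMem (by exact h)]; exact zero_le

omit [Fintype S] in
theorem lintegral_stopped_eq_measure_visited [Finite S] (μ : Measure (ℕ → S)) {F : Set S}
    {V : ℕ → S → ℝ≥0∞} {k : ℕ} (hV : ∀ y ∉ F, V k y = 0) :
    ∫⁻ ω, stopped F V k ω ∂μ = μ {ω | ∃ i ≤ k, ω i ∈ F} := by
  rw [← lintegral_indicator_one (measurableSet_visited F k)]
  refine lintegral_congr fun ω => ?_
  by_cases h : ∃ i ≤ k, ω i ∈ F
  · rw [stopped, if_pos h, Set.indicator_of_mem (by exact h)]; rfl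
  · rw [Set.indicator_of_notMem (by exact h), stopped, if_neg h, hV]
    exact fun hF => h ⟨k, le_rfl, hF⟩

omit [Fintype S] [MeasurableSingletonClass S] in
theorem measure_reach_eq_iSup (μ : Measure (ℕ → S)) (F : Set S) :
    μ {ω | ∃ k, ω k ∈ F} = ⨆ k, μ {ω | ∃ i ≤ k, ω i ∈ F} := by
  have : {ω : ℕ → S | ∃ k, ω k ∈ F} = ⋃ k, {ω | ∃ i ≤ k, ω i ∈ F} := by
    ext ω
    simp only [Set.mem_ofPred_eq, Set.mem_iUnion]
    exact ⟨fun ⟨k, h⟩ => ⟨k, k, le_rfl, h⟩, fun ⟨_, i, _, h⟩ => ⟨i, h⟩⟩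
  rw [this, Monotone.measure_iUnion]
  exact fun k l hkl ω ⟨i, hi, h⟩ => ⟨i, hi.trans hkl, h⟩

section Values

omit [MeasurableSpace S] [MeasurableSingletonClass S]

theorem rdp_of_mem (M : UMDP S A) {F : Set S} {s : S} (h : s ∈ F) (k : ℕ) : M.rdp F k s = 1 := by
  cases k <;> simp [rdp, h]

theorem rdpValue_of_mem (M : UMDP S A) {F : Set S} {s : S} (h : s ∈ F) : M.rdpValue F s = 1 := by
  simp [rdpValue, rdp_of_mem M h]

theorem rdp_succ_of_notMem (M : UMDP S A) {F : Set S} {s : S} (h : s ∉ F) (k : ℕ) :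
    M.rdp F (k + 1) s = ⨆ a : A, ⨅ γ ∈ M.Γ s a, ∑ s' : S, γ s' * M.rdp F k s' := by
  simp [rdp, h]

theorem sum_mul_le_of_le (γ : PMF S) {V : S → ℝ≥0∞} {c : ℝ≥0∞} (h : ∀ s, V s ≤ c) :
    ∑ s, γ s * V s ≤ c :=
  calc ∑ s, γ s * V s ≤ ∑ s, γ s * c := Finset.sum_le_sum fun s _ => by gcongr; exact h s
    _ = c := by rw [← Finset.sum_mul, ← tsum_fintype (L := .unconditional S), γ.tsum_coe, one_mul]

theorem rdp_le_one (M : UMDP S A) (hM : M.WellPosed) (F : Set S) (k : ℕ) (s : S) :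
    M.rdp F k s ≤ 1 := by
  induction k generalizing s with
  | zero => rw [rdp]; split_ifs <;> simp
  | succ k ih =>
    by_cases h : s ∈ F
    · exact (rdp_of_mem M h _).le
    · rw [rdp_succ_of_notMem M h]
      refine iSup_le fun a => ?_
      obtain ⟨γ, hγ⟩ := hM s a
      exact (iInf₂_le γ hγ).trans (sum_mul_le_of_le γ ih)

theorem rdpValue_le_one (M : UMDP S A) (hM : M.WellPosed) (F : Set S) (s : S) :
    M.rdpValue F s ≤ 1 := iSup_le fun k => rdp_le_one M hM F k s

/-- The UMDP without choice of actions that results from fixing the memoryless strategy `σ`; its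
robust dynamic programming recursion evaluates `σ`. -/
def induced {S A : Type*} (M : UMDP S A) (σ : S → A) : UMDP S Unit where
  Γ s _ := M.Γ s (σ s)

/-- The robust value of `σ` solves its Bellman equation up to arbitrary `ε`: since the recursion
converges uniformly on the finite state space, a nearly minimal distribution for a late iterate is
nearly minimal for the limit. No compactness of the sets `Γ s a` is used. -/
theorem exists_sum_mul_rdpValue_induced_le (M : UMDP S A) (hM : M.WellPosed) (σ : S → A)
    {F : Set S} {s : S} (hs : s ∉ F) {ε : ℝ≥0∞} (hε : ε ≠ 0) :
    ∃ γ ∈ M.Γ s (σ s),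
      ∑ s', γ s' * (M.induced σ).rdpValue F s' ≤ (M.induced σ).rdpValue F s + ε := by
  have hM' : (M.induced σ).WellPosed := fun s _ => hM s (σ s)
  have hε2 : ε / 2 ≠ 0 := (ENNReal.half_pos hε).ne'
  have hfin : ∀ y, (M.induced σ).rdpValue F y ≠ ⊤ := fun y =>
    ne_top_of_le_ne_top ENNReal.one_ne_top (rdpValue_le_one _ hM' F y)
  have hev : ∀ᶠ k in atTop, ∀ y, (M.induced σ).rdpValue F y ≤ (M.induced σ).rdp F k y + ε / 2 := by
    rw [eventually_all]
    intro y
    have hlim := ((M.induced σ).rdp_tendsto F y).add_const (ε / 2)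
    filter_upwards [hlim.eventually_const_lt (ENNReal.lt_add_right (hfin y) hε2)] with k hk
      using hk.le
  obtain ⟨k, hk⟩ := hev.exists
  have hlt : (M.induced σ).rdp F (k + 1) s < (M.induced σ).rdpValue F s + ε / 2 :=
    (le_iSup (fun k => (M.induced σ).rdp F k s) (k + 1)).trans_lt
      (ENNReal.lt_add_right (hfin s) hε2)
  rw [rdp_succ_of_notMem _ hs, iSup_unique] at hlt
  simp only [iInf_lt_iff] at hlt
  obtain ⟨γ, hγ, hlt⟩ := hlt
  refine ⟨γ, hγ, ?_⟩
  calc ∑ s', γ s' * (M.induced σ).rdpValue F s'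
      ≤ ∑ s', (γ s' * (M.induced σ).rdp F k s' + γ s' * (ε / 2)) :=
        Finset.sum_le_sum fun s' _ => by rw [← mul_add]; gcongr; exact hk s'
    _ ≤ ((M.induced σ).rdpValue F s + ε / 2) + ε / 2 := by
        rw [Finset.sum_add_distrib]
        exact add_le_add hlt.le (sum_mul_le_of_le γ fun _ => le_rfl)
    _ = (M.induced σ).rdpValue F s + ε := by rw [add_assoc, ENNReal.add_halves]

end Values

/-- Time-dependent adversaries push the reachability probability of a memoryless strategy down to
its robust value: at time `k` the adversary picks a distribution that is optimal up to `ε k`, with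
`∑ ε k` arbitrarily small, so that the stopped value process is nearly a supermartingale. -/
theorem worstReach_le_rdpValue_induced (M : UMDP S A) (hM : M.WellPosed) (F : Set S) (σ : S → A)
    (s : S) : M.worstReach F (fun ω => σ ω.last) s ≤ (M.induced σ).rdpValue F s := by
  classical
  refine ENNReal.le_of_forall_pos_le_add fun ε hε _ => ?_
  obtain ⟨ε', hε'pos, hε'sum⟩ :=
    ENNReal.exists_pos_sum_of_countable' (ENNReal.coe_ne_zero.2 hε.ne') ℕ
  set v := (M.induced σ).rdpValue F with hv
  have hγ : ∀ y k, ∃ γ ∈ M.Γ y (σ y), y ∉ F → ∑ s', γ s' * v s' ≤ v y + ε' k := by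
    intro y k
    by_cases hy : y ∈ F
    · obtain ⟨γ, hγ⟩ := hM y (σ y)
      exact ⟨γ, hγ, fun h => absurd hy h⟩
    · obtain ⟨γ, hγ, h⟩ := exists_sum_mul_rdpValue_induced_le M hM σ hy (hε'pos k).ne'
      exact ⟨γ, hγ, fun _ => h⟩
  choose γ hγmem hγle using hγ
  -- actions other than `σ y` are never played, so any admissible distribution serves there
  let ξ : M.Adversary := ⟨fun y a k => if a = σ y then γ y k else (hM y a).some, fun y a k => by
    beta_reduce
    split_ifs with h
    · rw [h]; exact hγmem y k
    · exact (hM y a).some_mem⟩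
  set μ := M.pathMeasure (FinPath.markovStrategy fun _ => σ) ξ s
  have hstep : ∀ k, ∫⁻ ω, stopped F (fun _ => v) (k + 1) ω ∂μ ≤
      ∫⁻ ω, stopped F (fun _ => v) k ω ∂μ + ε' k := by
    intro k
    rw [lintegral_stopped_succ M (fun _ => σ) ξ s k (fun y hy => rdpValue_of_mem _ hy)]
    have hc : ∫⁻ _, ε' k ∂μ = ε' k := by simp
    rw [← hc, ← lintegral_add_right _ measurable_const]
    refine lintegral_mono fun ω => ?_
    simp only [stopped]
    split_ifs with h
    · exact le_self_add
    · simp only [ξ, if_true]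
      exact hγle _ _ fun hF => h ⟨k, le_rfl, hF⟩
  have hbound : ∀ k, ∫⁻ ω, stopped F (fun _ => v) k ω ∂μ ≤ v s + ∑ j ∈ Finset.range k, ε' j := by
    intro k
    induction k with
    | zero =>
      rw [Finset.range_zero, Finset.sum_empty, add_zero]
      exact (lintegral_stopped_zero M _ ξ s (V := fun _ => v)
        fun y hy => rdpValue_of_mem _ hy).le
    | succ k ih =>
      rw [Finset.sum_range_succ, ← add_assoc]
      exact (hstep k).trans (by gcongr)
  refine (iInf_le _ ξ).trans ?_
  change μ {ω | ∃ k, ω k ∈ F} ≤ _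
  rw [measure_reach_eq_iSup]
  refine iSup_le fun k => (measure_visited_le_lintegral_stopped μ F _ k).trans ((hbound k).trans ?_)
  gcongr
  exact (ENNReal.sum_le_tsum _).trans hε'sum.le

/-- Robust dynamic programming is a lower bound for the optimal robust reachability probability: the
strategy that is greedy for the `k`-step recursion makes the stopped iterates a submartingale. -/
theorem rdpValue_le_optReach [Finite A] [Nonempty A] (M : UMDP S A) (F : Set S) (s : S) :
    M.rdpValue F s ≤ M.optReach F s := by
  classical
  refine iSup_le fun k => ?_
  have hgreedy : ∀ j y, ∃ a : A, y ∉ F →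
      M.rdp F (j + 1) y ≤ ⨅ γ ∈ M.Γ y a, ∑ s' : S, γ s' * M.rdp F j s' := by
    intro j y
    obtain ⟨a, ha⟩ := exists_eq_ciSup_of_finite
      (f := fun a : A => ⨅ γ ∈ M.Γ y a, ∑ s' : S, γ s' * M.rdp F j s')
    exact ⟨a, fun hy => by rw [rdp_succ_of_notMem M hy, ← ha]⟩
  choose π hπ using hgreedy
  -- at time `i` there remain `k - i` steps, and the greedy action looks `k - (i + 1)` steps ahead
  refine le_iSup_of_le (FinPath.markovStrategy fun i => π (k - (i + 1))) (le_iInf fun ξ => ?_)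
  set μ := M.pathMeasure (FinPath.markovStrategy fun i => π (k - (i + 1))) ξ s
  set V : ℕ → S → ℝ≥0∞ := fun j => M.rdp F (k - j) with hVdef
  have hVF : ∀ j, ∀ y ∈ F, V j y = 1 := fun j y hy => rdp_of_mem M hy _
  have hbound : ∀ j ≤ k, V 0 s ≤ ∫⁻ ω, stopped F V j ω ∂μ := by
    intro j
    induction j with
    | zero => exact fun _ => (lintegral_stopped_zero M _ ξ s (hVF 0)).ge
    | succ j ih =>
      intro hj
      refine (ih (by omega)).trans ?_
      rw [lintegral_stopped_succ M _ ξ s j (hVF (j + 1))]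
      refine lintegral_mono fun ω => ?_
      simp only [stopped]
      split_ifs with h
      · exact le_rfl
      · have hF : ω j ∉ F := fun hF => h ⟨j, le_rfl, hF⟩
        have hkj : k - j = k - (j + 1) + 1 := by omega
        simp only [hVdef]
        rw [hkj]
        exact (hπ _ _ hF).trans (iInf₂_le _ (ξ.2 _ _ _))
  refine (hbound k le_rfl).trans ?_
  rw [lintegral_stopped_eq_measure_visited μ (fun y hy => by simp [hVdef, rdp, hy])]
  exact measure_mono fun ω ⟨i, _, h⟩ => ⟨i, h⟩

/-- The robust value of an optimal memoryless strategy is at least the value of robust dynamic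
programming. -/
theorem IsOptimal.rdpValue_le [Finite A] {M : UMDP S A} (hM : M.WellPosed) {F : Set S} {σ : S → A}
    (hσ : M.IsOptimal F σ) (s : S) : M.rdpValue F s ≤ (M.induced σ).rdpValue F s := by
  have : Nonempty A := ⟨σ s⟩
  exact (rdpValue_le_optReach M F s).trans
    ((hσ s).symm.le.trans (worstReach_le_rdpValue_induced M hM F σ s))

end UMDP

/-! ### Random recursions driven by an i.i.d. sequence -/

section Orbit

variable {Y V : Type*}

/-- The orbit `y, G y w₀, G (G y w₀) w₁, …` of `y` driven by the sequence `w`. -/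
def orbit (G : Y → V → Y) (y : Y) (w : ℕ → V) : ℕ → Y
  | 0 => y
  | k + 1 => G (orbit G y w k) (w k)

/-- The sequence with first term `p.1` and tail `p.2`. -/
def consSeq (p : V × (ℕ → V)) : ℕ → V
  | 0 => p.1
  | k + 1 => p.2 k

theorem orbit_consSeq (G : Y → V → Y) (y : Y) (p : V × (ℕ → V)) (k : ℕ) :
    orbit G y (consSeq p) (k + 1) = orbit G (G y p.1) p.2 k := by
  induction k with
  | zero => rfl
  | succ k ih => rw [orbit, ih]; rfl

variable [MeasurableSpace V]

theorem measurable_consSeq : Measurable (consSeq : V × (ℕ → V) → ℕ → V) := by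
  refine measurable_pi_lambda _ fun k => ?_
  cases k with
  | zero => exact measurable_fst
  | succ k => exact (measurable_pi_apply k).comp measurable_snd

theorem measurePreserving_consSeq (P : Measure V) [IsProbabilityMeasure P] :
    MeasurePreserving consSeq (P.prod (Measure.infinitePi fun _ : ℕ => P))
      (Measure.infinitePi fun _ : ℕ => P) := by
  classical
  refine ⟨measurable_consSeq, Measure.eq_infinitePi (fun _ : ℕ => P) fun s t ht => ?_⟩
  have ht' : MeasurableSet ((s : Set ℕ).pi t) := .pi s.countable_toSet fun i _ => ht i
  -- enlarging the index set to an initial segment separates the first coordinate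
  obtain ⟨n, hn⟩ : ∃ n, s ⊆ Finset.range (n + 1) :=
    ⟨s.sup id, fun i hi => Finset.mem_range.2 (Nat.lt_succ_of_le (Finset.le_sup (f := id) hi))⟩
  set t' : ℕ → Set V := fun i => if i ∈ s then t i else Set.univ with ht'def
  have hm : ∀ i, MeasurableSet (t' i) := fun i => by
    simp only [ht'def]; split_ifs; exacts [ht i, .univ]
  have hpre : consSeq ⁻¹' ((s : Set ℕ).pi t) =
      t' 0 ×ˢ ((Finset.range n : Set ℕ).pi fun i => t' (i + 1)) := by
    ext p
    simp only [Set.mem_preimage, Set.mem_pi, Finset.mem_coe, Set.mem_prod, Finset.mem_range, ht'def]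
    constructor
    · intro h
      refine ⟨?_, fun i _ => ?_⟩
      · split_ifs with h0; exacts [h 0 h0, trivial]
      · split_ifs with h0; exacts [h (i + 1) h0, trivial]
    · rintro ⟨h0, h1⟩ i hi
      cases i with
      | zero => simpa [hi, consSeq] using h0
      | succ i =>
        have := h1 i (by have := Finset.mem_range.1 (hn hi); omega)
        simpa [hi, consSeq] using this
  rw [Measure.map_apply measurable_consSeq ht', hpre, Measure.prod_prod,
    Measure.infinitePi_pi _ fun i _ => hm (i + 1), mul_comm,
    ← Finset.prod_range_succ' (fun i => P (t' i)),
    ← Finset.prod_subset hn (fun i _ hi => by simp [ht'def, hi])]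
  exact Finset.prod_congr rfl fun i hi => by simp [ht'def, hi]

variable [MeasurableSpace Y]

theorem measurable_orbit {G : Y → V → Y} (hG : Measurable (Function.uncurry G)) (k : ℕ) :
    Measurable fun p : Y × (ℕ → V) => orbit G p.1 p.2 k := by
  induction k with
  | zero => exact measurable_fst
  | succ k ih => exact hG.comp (ih.prodMk ((measurable_pi_apply k).comp measurable_snd))

/-- The probability that the orbit of `y` visits `F` up to time `k`. -/
noncomputable def hitProb (P : Measure V) (G : Y → V → Y) (F : Set Y) (k : ℕ) (y : Y) : ℝ≥0∞ :=
  Measure.infinitePi (fun _ : ℕ => P) {w | ∃ i ≤ k, orbit G y w i ∈ F}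

omit [MeasurableSpace Y] in
theorem hitProb_of_mem (P : Measure V) [IsProbabilityMeasure P] (G : Y → V → Y) {F : Set Y} (k : ℕ)
    {y : Y} (hy : y ∈ F) : hitProb P G F k y = 1 := by
  have : {w : ℕ → V | ∃ i ≤ k, orbit G y w i ∈ F} = Set.univ :=
    Set.eq_univ_of_forall fun w => ⟨0, Nat.zero_le _, hy⟩
  rw [hitProb, this, measure_univ]

/-- First-step inequality. -/
theorem lintegral_hitProb_le (P : Measure V) [IsProbabilityMeasure P] {G : Y → V → Y}
    (hG : Measurable (Function.uncurry G)) {F : Set Y} (hF : MeasurableSet F) (k : ℕ) (y : Y) :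
    ∫⁻ v, hitProb P G F k (G y v) ∂P ≤ hitProb P G F (k + 1) y := by
  have hE : ∀ k, MeasurableSet {p : Y × (ℕ → V) | ∃ i ≤ k, orbit G p.1 p.2 i ∈ F} := by
    intro k
    have : {p : Y × (ℕ → V) | ∃ i ≤ k, orbit G p.1 p.2 i ∈ F} =
        ⋃ i ∈ Set.Iic k, (fun p : Y × (ℕ → V) => orbit G p.1 p.2 i) ⁻¹' F := by
      ext; simp
    rw [this]
    exact .biUnion (Set.to_countable _) fun i _ => measurable_orbit hG i hF
  have hGy : Measurable fun p : V × (ℕ → V) => (G y p.1, p.2) :=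
    (hG.comp (measurable_const.prodMk measurable_fst)).prodMk measurable_snd
  have hEy : MeasurableSet {w : ℕ → V | ∃ i ≤ k + 1, orbit G y w i ∈ F} :=
    (measurable_const.prodMk measurable_id : Measurable fun w : ℕ → V => (y, w)) (hE (k + 1))
  rw [hitProb, ← (measurePreserving_consSeq P).measure_preimage hEy.nullMeasurableSet]
  calc ∫⁻ v, hitProb P G F k (G y v) ∂P
      = (P.prod (Measure.infinitePi fun _ : ℕ => P))
          ((fun p : V × (ℕ → V) => (G y p.1, p.2)) ⁻¹'
            {p | ∃ i ≤ k, orbit G p.1 p.2 i ∈ F}) := by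
        rw [Measure.prod_apply (hGy (hE k))]; rfl
    _ ≤ _ := by
        refine measure_mono fun p hp => ?_
        obtain ⟨i, hi, h⟩ := hp
        exact ⟨i + 1, Nat.succ_le_succ hi, by rwa [orbit_consSeq]⟩

end Orbit

/-! ### The automaton on the closed loop -/

section Automaton

variable {AP Z : Type*}

/-- No continuation of a run from the state `z` is accepted. -/
def DFA.IsDead (D : DFA (Set AP) Z) (z : Z) : Prop := ∀ ρ, D.evalFrom z ρ ∉ D.accept

theorem DFA.IsDead.step {D : DFA (Set AP) Z} {z : Z} (h : D.IsDead z) (l : Set AP) :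
    D.IsDead (D.step z l) := fun ρ => h (l :: ρ)

theorem LTLf.sat_globally_neg_atom {ρ : List (Set AP)} {p : AP}
    (h : LTLf.Sat ρ (LTLf.globally (.neg (.atom p)))) : ∀ l ∈ ρ, p ∉ l := by
  intro l hl hp
  obtain ⟨i, hi, rfl⟩ := List.getElem_of_mem hl
  refine h ⟨i, Nat.zero_le _, hi, ?_, fun _ _ _ => trivial⟩
  exact fun hn => hn ⟨hi, hp⟩

/-- Once the trace has seen the unsafe proposition, the automaton rejects forever. -/
theorem DFA.Recognises.isDead {D : DFA (Set AP) Z} {φ' φ : LTLf AP} {p : AP}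
    (hφ : φ = φ'.conj (LTLf.globally (.neg (.atom p)))) (hD : D.Recognises φ)
    {ρ : List (Set AP)} {l : Set AP} (hl : l ∈ ρ) (hp : p ∈ l) : D.IsDead (D.eval ρ) := by
  intro ρ' hacc
  have hacc' : D.eval (ρ ++ ρ') ∈ D.accept := by
    rwa [DFA.eval, DFA.evalFrom_of_append]
  rw [hD _ (by rintro h; simp_all)] at hacc'
  subst hφ
  exact LTLf.sat_globally_neg_atom hacc'.2 l (List.mem_append_left _ hl) hp

end Automaton

/-! ### The product with the automaton -/

namespace UMDP

section Product

variable {S A AP Z : Type*} {L : S → Set AP} {D : DFA (Set AP) Z}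

theorem map_mem_product (M : UMDP S A) {s : S} {a : A} {γ : PMF S} (hγ : γ ∈ M.Γ s a) (z : Z) :
    γ.map (fun s' => (s', D.step z (L s'))) ∈ (M.product L D).Γ (s, z) a := by
  classical
  refine ⟨γ, hγ, fun s' => ?_⟩
  rw [PMF.map_apply, tsum_eq_single s']
  · simp
  · intro s'' h
    rw [if_neg]
    simp only [Prod.mk.injEq, not_and]
    exact fun h' => absurd h'.symm h

theorem WellPosed.product {M : UMDP S A} (hM : M.WellPosed) : (M.product L D).WellPosed :=
  fun sz a => ⟨_, map_mem_product M (hM sz.1 a).some_mem sz.2⟩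

theorem sum_map_mul {S T : Type*} [Fintype S] [Fintype T] (γ : PMF S) (g : S → T) (V : T → ℝ≥0∞) :
    ∑ t, γ.map g t * V t = ∑ s, γ s * V (g s) := by
  classical
  simp only [PMF.map_apply, tsum_fintype, Finset.sum_mul]
  rw [Finset.sum_comm]
  exact Finset.sum_congr rfl fun s _ => by simp [ite_mul]

variable [Fintype S] [Fintype Z]

theorem rdp_induced_product_succ_le (M : UMDP S A) (σ : S × Z → A) (k : ℕ) {s : S} {z : Z}
    (hz : z ∉ D.accept) {γ : PMF S} (hγ : γ ∈ M.Γ s (σ (s, z))) :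
    ((M.product L D).induced σ).rdp (acceptingStates S D) (k + 1) (s, z) ≤
      ∑ s', γ s' * ((M.product L D).induced σ).rdp (acceptingStates S D) k
        (s', D.step z (L s')) := by
  rw [rdp_succ_of_notMem _ (by exact hz), iSup_unique]
  refine (iInf₂_le _ (map_mem_product M hγ z)).trans ?_
  rw [sum_map_mul]

theorem rdp_eq_zero_of_isDead {M : UMDP S A} (hM : M.WellPosed) (σ : S × Z → A) (k : ℕ) (s : S)
    {z : Z} (hz : D.IsDead z) :
    ((M.product L D).induced σ).rdp (acceptingStates S D) k (s, z) = 0 := by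
  have hacc : ∀ {z}, D.IsDead z → z ∉ D.accept := fun h => h []
  induction k generalizing s z with
  | zero => rw [rdp, if_neg (by exact hacc hz)]
  | succ k ih =>
    refine le_antisymm ?_ zero_le
    refine (rdp_induced_product_succ_le M σ k (hacc hz) (hM s (σ (s, z))).some_mem).trans ?_
    simp [ih _ (hz.step _)]

end Product

end UMDP

/-! ### The closed loop and its abstraction -/

/-- The law of a random variable with finitely many values, as a `PMF`. -/
noncomputable def lawPMF {V S : Type*} [MeasurableSpace V] [Finite S] [MeasurableSpace S]
    [MeasurableSingletonClass S] (P : Measure V) [IsProbabilityMeasure P] {g : V → S}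
    (hg : Measurable g) : PMF S :=
  haveI := Measure.isProbabilityMeasure_map (μ := P) hg.aemeasurable
  (P.map g).toPMF

section LawPMF

variable {V S : Type*} [MeasurableSpace V] [Fintype S] [MeasurableSpace S]
  [MeasurableSingletonClass S] (P : Measure V) [IsProbabilityMeasure P] {g : V → S}

theorem sum_lawPMF_mul (hg : Measurable g) (h : S → ℝ≥0∞) :
    ∑ s, lawPMF P hg s * h s = ∫⁻ v, h (g v) ∂P := by
  have := Measure.isProbabilityMeasure_map (μ := P) hg.aemeasurable
  rw [← UMDP.lintegral_toMeasure, lawPMF, Measure.toPMF_toMeasure,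
    lintegral_map (measurable_of_finite h) hg]

theorem sum_toReal_lawPMF (hg : Measurable g) (q : Finset S) :
    ∑ s ∈ q, (lawPMF P hg s).toReal = P.real (g ⁻¹' q) := by
  have := Measure.isProbabilityMeasure_map (μ := P) hg.aemeasurable
  have h : ∀ s, (lawPMF P hg s).toReal = (P.map g).real {s} := fun s => rfl
  simp only [h]
  rw [sum_measureReal_singleton, map_measureReal_apply hg q.measurableSet]

end LawPMF

section ClosedLoop

variable {E U V S AP Z : Type*}

/-- One step of the joint evolution of the system state and the automaton state, when the action is
chosen by the memoryless strategy `σ` of the product. -/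
def closedLoop (f : E → U → V → E) (J : E → S) (ℓ : E → Set AP) (D : DFA (Set AP) Z)
    (σ : S × Z → U) (y : E × Z) (w : V) : E × Z :=
  (f y.1 (σ (J y.1, y.2)) w, D.step y.2 (ℓ (f y.1 (σ (J y.1, y.2)) w)))

theorem orbit_closedLoop (f : E → U → V → E) (J : E → S) (ℓ : E → Set AP) (D : DFA (Set AP) Z)
    (σ : S × Z → U) (x : E) (w : ℕ → V) (k : ℕ) :
    orbit (closedLoop f J ℓ D σ) (x, D.step D.start (ℓ x)) w k =
      ((sysPath f (refineStrategy J ℓ D σ) x w k).last,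
        D.eval ((sysPath f (refineStrategy J ℓ D σ) x w k).trace ℓ)) := by
  induction k with
  | zero => rfl
  | succ k ih =>
    rw [orbit, ih, sysPath]
    simp only [closedLoop, FinPath.last, FinPath.trace, DFA.eval_append_singleton]
    rfl

theorem FinPath.trace_ne_nil (ℓ : E → Set AP) (ω : FinPath E U) : ω.trace ℓ ≠ [] := by
  cases ω <;> simp [FinPath.trace]

theorem hitProb_closedLoop_le_satProb [MeasurableSpace V] (P : Measure V) (f : E → U → V → E)
    (J : E → S) (ℓ : E → Set AP) {D : DFA (Set AP) Z} {φ : LTLf AP} (hD : D.Recognises φ)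
    (σ : S × Z → U) (k : ℕ) (x : E) :
    hitProb P (closedLoop f J ℓ D σ) {y | y.2 ∈ D.accept} k (x, D.step D.start (ℓ x)) ≤
      satProb f P ℓ φ (refineStrategy J ℓ D σ) x := by
  refine measure_mono fun w ⟨i, _, h⟩ => ⟨i, ?_⟩
  rw [orbit_closedLoop] at h
  exact (hD _ (FinPath.trace_ne_nil ℓ _)).1 h

variable [MeasurableSpace E] [MeasurableSpace V] [Fintype S] [MeasurableSpace S]
  [MeasurableSingletonClass S] [Fintype Z] [MeasurableSpace Z] [MeasurableSingletonClass Z]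

theorem measurable_closedLoop [Finite U] {f : E → U → V → E}
    (hf : ∀ u, Measurable fun p : E × V => f p.1 u p.2) {J : E → S} (hJ : Measurable J)
    {ℓ : E → Set AP} (hℓ : ∀ x, absLabel J ℓ (J x) = ℓ x) (D : DFA (Set AP) Z) (σ : S × Z → U) :
    Measurable (Function.uncurry (closedLoop f J ℓ D σ)) := by
  let _ : MeasurableSpace U := ⊤
  have hf' : Measurable fun p : U × (E × V) => f p.2.1 p.1 p.2.2 :=
    measurable_from_prod_countable_right hf
  have hσ : Measurable fun p : (E × Z) × V => σ (J p.1.1, p.1.2) :=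
    (measurable_of_finite σ).comp
      ((hJ.comp measurable_fst.fst).prodMk measurable_fst.snd)
  have hx : Measurable fun p : (E × Z) × V => f p.1.1 (σ (J p.1.1, p.1.2)) p.2 :=
    hf'.comp (hσ.prodMk (measurable_fst.fst.prodMk measurable_snd))
  have hz : Measurable fun p : (E × Z) × V =>
      D.step p.1.2 (absLabel J ℓ (J (f p.1.1 (σ (J p.1.1, p.1.2)) p.2))) :=
    (measurable_of_finite fun q : Z × S => D.step q.1 (absLabel J ℓ q.2)).comp
      (measurable_fst.snd.prodMk (hJ.comp hx))
  simp only [hℓ] at hz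
  exact hx.prodMk hz

/-- The abstraction is sound: if the sets `Γ` contain the true transition laws from all safe states,
the robust value of `σ` in the product is a lower bound for the probability that the refined strategy
satisfies `φ`. From the unsafe region the true laws are not in `Γ`, but there the automaton is dead
and the robust value vanishes. -/
theorem rdpValue_induced_le_satProb [Finite U] (P : Measure V) [IsProbabilityMeasure P]
    {f : E → U → V → E} (hf : ∀ u, Measurable fun p : E × V => f p.1 u p.2)
    {J : E → S} (hJ : Measurable J) {ℓ : E → Set AP} (hℓ : ∀ x, absLabel J ℓ (J x) = ℓ x)
    {D : DFA (Set AP) Z} {φ' φ : LTLf AP} {p : AP}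
    (hφ : φ = φ'.conj (LTLf.globally (.neg (.atom p)))) (hD : D.Recognises φ)
    {su : S} (hsu : ∀ x, J x = su → p ∈ ℓ x) {M : UMDP S U} (hM : M.WellPosed)
    (hfm : ∀ x u, Measurable fun w => J (f x u w))
    (hΓ : ∀ x u, J x ≠ su → lawPMF P (hfm x u) ∈ M.Γ (J x) u) (σ : S × Z → U) (x : E) :
    ((M.product (absLabel J ℓ) D).induced σ).rdpValue (acceptingStates S D)
        (J x, D.step D.start (absLabel J ℓ (J x))) ≤
      satProb f P ℓ φ (refineStrategy J ℓ D σ) x := by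
  refine iSup_le fun k => ?_
  rw [hℓ]
  refine le_trans ?_ (hitProb_closedLoop_le_satProb P f J ℓ hD σ k x)
  have hF : MeasurableSet {y : E × Z | y.2 ∈ D.accept} :=
    measurable_snd (Set.toFinite D.accept).measurableSet
  have key : ∀ k x ρ, (J x = su → D.IsDead (D.eval ρ)) →
      ((M.product (absLabel J ℓ) D).induced σ).rdp (acceptingStates S D) k (J x, D.eval ρ) ≤
        hitProb P (closedLoop f J ℓ D σ) {y | y.2 ∈ D.accept} k (x, D.eval ρ) := by
    intro k
    induction k with
    | zero =>
      intro x ρ _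
      by_cases hacc : D.eval ρ ∈ D.accept
      · rw [hitProb_of_mem P _ _ (by exact hacc), UMDP.rdp_of_mem _ (by exact hacc)]
      · rw [UMDP.rdp, if_neg (by exact hacc)]; exact zero_le
    | succ k ih =>
      intro x ρ hx
      by_cases hdead : D.IsDead (D.eval ρ)
      · rw [UMDP.rdp_eq_zero_of_isDead hM σ _ _ hdead]; exact zero_le
      by_cases hacc : D.eval ρ ∈ D.accept
      · rw [hitProb_of_mem P _ _ (by exact hacc), UMDP.rdp_of_mem _ (by exact hacc)]
      have hxs : J x ≠ su := fun h => hdead (hx h)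
      refine (UMDP.rdp_induced_product_succ_le M σ k hacc
        (hΓ x (σ (J x, D.eval ρ)) hxs)).trans ?_
      rw [sum_lawPMF_mul P (hfm _ _) fun s' =>
        ((M.product (absLabel J ℓ) D).induced σ).rdp (acceptingStates S D) k
          (s', D.step (D.eval ρ) (absLabel J ℓ s'))]
      refine le_trans (lintegral_mono fun w => ?_)
        (lintegral_hitProb_le P (measurable_closedLoop hf hJ hℓ D σ) hF k _)
      simp only [hℓ, closedLoop]
      rw [← DFA.eval_append_singleton]
      exact ih _ _ fun h => DFA.Recognises.isDead hφ hD
        (List.mem_append_right _ (List.mem_singleton_self _)) (hsu _ h)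
  have h := key k x [ℓ x] fun h =>
    DFA.Recognises.isDead hφ hD (List.mem_singleton_self _) (hsu x h)
  rwa [DFA.eval_singleton] at h

end ClosedLoop

/-! ### The learned abstraction contains the true transition laws -/

theorem absLabel_labelOf {E S AP : Type*} {J : E → S} {X : Set E} {Rint : Set (Set E)}
    {lab : Set E → Set AP} {su : S} (hsu : J ⁻¹' {su} = Xᶜ)
    (hJR : ∀ r ∈ Rint, ∀ s, J ⁻¹' {s} ⊆ r ∨ Disjoint (J ⁻¹' {s}) r) (x : E) :
    absLabel J (labelOf X Rint lab) (J x) = labelOf X Rint lab x := by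
  ext p
  refine ⟨fun h => h x rfl, ?_⟩
  rintro ⟨r, hr, hxr, hp⟩ x' hx'
  refine ⟨r, hr, ?_, hp⟩
  rcases Set.mem_insert_iff.1 hr with rfl | hr
  · rw [← hsu] at hxr ⊢
    exact hx'.trans hxr
  · rcases hJR r hr (J x) with h | h
    · exact h hx'
    · exact absurd hxr (Set.disjoint_left.1 h rfl)

theorem lawPMF_mem_abstraction {E U S : Type*} [MeasurableSpace E] [Fintype S] [DecidableEq S]
    [MeasurableSpace S] [MeasurableSingletonClass S] {d N : ℕ}
    {W : Set (EuclideanSpace ℝ (Fin d))} (P : Measure W) [IsProbabilityMeasure P]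
    {f : E → U → W → E} {J : E → S} {su : S} {β εc : ℝ} {ŵ : Fin N → W}
    {Qsa : S → U → Finset (Finset S)} {x : E} {a : U}
    (hfm : Measurable fun w => J (f x a w)) (hx : J x ≠ su)
    (hcover : post f J (radius ŵ) (J x) a ⊆ ((Qsa (J x) a).biUnion id : Finset S))
    (hrad : 1 - εc ≤ P.real {w | ‖(w : EuclideanSpace ℝ (Fin d))‖ ≤ radius ŵ})
    (hC : ∀ s' ∈ (Qsa (J x) a).biUnion id,
      ŵ ∉ boundsFail P f β (J ⁻¹' {J x}) a (J ⁻¹' {s'}))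
    (hQ : ∀ q ∈ Qsa (J x) a, ŵ ∉ boundsFail P f β (J ⁻¹' {J x}) a (J ⁻¹' (q : Set S))) :
    lawPMF P hfm ∈ (abstraction f J su β εc ŵ Qsa).Γ (J x) a := by
  have hbounds : ∀ q : Finset S, ŵ ∉ boundsFail P f β (J ⁻¹' {J x}) a (J ⁻¹' (q : Set S)) →
      lowerP f β ŵ (J ⁻¹' {J x}) a (J ⁻¹' (q : Set S)) ≤ ∑ s' ∈ q, (lawPMF P hfm s').toReal ∧
      ∑ s' ∈ q, (lawPMF P hfm s').toReal ≤ upperP f β ŵ (J ⁻¹' {J x}) a (J ⁻¹' (q : Set S)) := by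
    intro q hq
    rw [sum_toReal_lawPMF]
    exact ⟨le_of_not_gt fun h => hq (Or.inl ⟨x, rfl, h⟩),
      le_of_not_gt fun h => hq (Or.inr ⟨x, rfl, h⟩)⟩
  simp only [abstraction, if_neg hx]
  refine ⟨fun s' hs' => ?_, fun q hq => hbounds q (hQ q hq), ?_⟩
  · simpa using hbounds {s'} (by simpa using hC s' hs')
  · rw [sum_toReal_lawPMF]
    exact hrad.trans (measureReal_mono fun w hw => hcover ⟨x, w, rfl, hw, rfl⟩)

/-- The data-dependent selections of confidence loss at most `α` are all contained in one of them:
they form a finite chain. -/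
theorem exists_largest_selection {U S : Type*} [Finite U] [Finite S] {su : S}
    {Qsa : ℝ → S → U → Finset (Finset S)}
    (hmono : ∀ c c', c ≤ c' → ∀ s, s ≠ su → ∀ a, Qsa c s a ⊆ Qsa c' s a)
    {C : Set ℝ} (hC : C.Nonempty) :
    ∃ c₀ ∈ C, ∀ c ∈ C, ∀ s, s ≠ su → ∀ a, Qsa c s a ⊆ Qsa c₀ s a := by
  let g : ℝ → {s // s ≠ su} → U → Finset (Finset S) := fun c s a => Qsa c s a
  have hg : Monotone g := fun c c' h s a => hmono c c' h s s.2 a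
  obtain ⟨_, ⟨c₀, hc₀, rfl⟩, hmax⟩ :=
    (Set.toFinite (g '' C)).exists_maximal (hC.image g)
  refine ⟨c₀, hc₀, fun c hc s hs a => ?_⟩
  have h : g c ≤ g c₀ := (le_total c c₀).elim (fun h => hg h)
    fun h => hmax ⟨c, hc, rfl⟩ (hg h)
  exact h ⟨s, hs⟩ a

/-- The confidence loss is the union bound over the failure of the learned support and of all
interval bounds of the selected states and clusters. -/
theorem measure_pi_abstraction_fails_le {E U S : Type*} [MeasurableSpace E] [Fintype U]
    [Fintype S] [DecidableEq S] [MeasurableSpace S] [MeasurableSingletonClass S] {d N : ℕ}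
    {W : Set (EuclideanSpace ℝ (Fin d))} (P : Measure W) [IsProbabilityMeasure P]
    {f : E → U → W → E} (hf : ∀ x a, Measurable (f x a)) {J : E → S} (hJ : Measurable J) (su : S)
    {β εc βc : ℝ} (hβ : β ∈ Set.Ioo (0 : ℝ) 1) (hεc : εc ∈ Set.Ioo (0 : ℝ) 1) (hβc : 0 < βc)
    (hN : 0 < N) (hNc : Real.log (1 / βc) / Real.log (1 / (1 - εc)) ≤ N)
    (Qsa : S → U → Finset (Finset S)) :
    Measure.pi (fun _ : Fin N => P)
      ({ŵ | P.real {w | ‖(w : EuclideanSpace ℝ (Fin d))‖ ≤ radius ŵ} < 1 - εc} ∪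
        ⋃ s ∈ Finset.univ.erase su, ⋃ a ∈ (Finset.univ : Finset U),
          ((⋃ s' ∈ (Qsa s a).biUnion id, boundsFail P f β (J ⁻¹' {s}) a (J ⁻¹' {s'})) ∪
            ⋃ q ∈ Qsa s a, boundsFail P f β (J ⁻¹' {s}) a (J ⁻¹' (q : Set S))))
      ≤ ENNReal.ofReal (confidenceLoss su β βc Qsa) := by
  have hm : ∀ B : Set S, MeasurableSet (J ⁻¹' B) := fun B => hJ (Set.toFinite B).measurableSet
  rw [confidenceLoss, ENNReal.ofReal_add hβc.le (by have := hβ.1; positivity), Finset.sum_mul,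
    ENNReal.ofReal_sum_of_nonneg fun s _ => by have := hβ.1; positivity]
  refine (measure_union_le _ _).trans (add_le_add (measure_pi_radius_lt_le P hεc hβc hNc) ?_)
  refine (measure_biUnion_finset_le _ _).trans (Finset.sum_le_sum fun s _ => ?_)
  rw [Finset.sum_mul, ENNReal.ofReal_sum_of_nonneg fun s _ => by have := hβ.1; positivity]
  refine (measure_biUnion_finset_le _ _).trans (Finset.sum_le_sum fun a _ => ?_)
  rw [add_mul, ENNReal.ofReal_add (by have := hβ.1; positivity) (by have := hβ.1; positivity),
    ENNReal.ofReal_mul (Nat.cast_nonneg _), ENNReal.ofReal_mul (Nat.cast_nonneg _),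
    ENNReal.ofReal_natCast, ENNReal.ofReal_natCast, ← nsmul_eq_mul, ← nsmul_eq_mul]
  refine (measure_union_le _ _).trans (add_le_add ?_ ?_) <;>
  · refine (measure_biUnion_finset_le _ _).trans (Finset.sum_le_card_nsmul _ _ _ fun B _ => ?_)
    exact measure_pi_boundsFail_le P hN f a (fun x => hf x a) hβ _ (hm _)

theorem theorem2
    {n d N : ℕ} {U S Z AP : Type*} [Fintype U] [Finite AP]
    [Fintype S] [DecidableEq S] [MeasurableSpace S] [MeasurableSingletonClass S]
    [Fintype Z] [MeasurableSpace Z] [MeasurableSingletonClass Z]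
    -- the system and the disturbance
    (W : Set (EuclideanSpace ℝ (Fin d))) (P : Measure W) [IsProbabilityMeasure P]
    (f : EuclideanSpace ℝ (Fin n) → U → W → EuclideanSpace ℝ (Fin n))
    (hf : ∀ u, Measurable fun y : EuclideanSpace ℝ (Fin n) × W => f y.1 u y.2)
    -- the safe set, the regions of interest and their labels
    (X : Set (EuclideanSpace ℝ (Fin n))) (hXm : MeasurableSet X) (hXb : Bornology.IsBounded X)
    (hLip : ∀ u, ∃ Lu : ℝ, 0 < Lu ∧ ∀ x ∈ X, ∀ w w' : W,
      ‖f x u w - f x u w'‖ ≤ Lu * ‖(w : EuclideanSpace ℝ (Fin d)) - w'‖)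
    (Rint : Set (Set (EuclideanSpace ℝ (Fin n))))
    (hRint : ∀ r ∈ Rint, MeasurableSet r ∧ r ⊆ X)
    (lab : Set (EuclideanSpace ℝ (Fin n)) → Set AP)
    (pUnsafe : AP) (hUnsafe : pUnsafe ∈ lab Xᶜ)
    -- the specification `φ = φ' ∧ □ ¬ pUnsafe` and its automaton
    (φ' φ : LTLf AP) (hφ : φ = φ'.conj (LTLf.globally (.neg (.atom pUnsafe))))
    (D : DFA (Set AP) Z) (hD : D.Recognises φ)
    -- the finite measurable partition, which respects `X` and the regions of interest
    (J : EuclideanSpace ℝ (Fin n) → S) (hJm : Measurable J) (hJs : Function.Surjective J)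
    (su : S) (hsu : J ⁻¹' {su} = Xᶜ)
    (hJR : ∀ r ∈ Rint, ∀ s, J ⁻¹' {s} ⊆ r ∨ Disjoint (J ⁻¹' {s}) r)
    -- the clustering, and the clusters selected when the learned support has radius `c`
    (Q : Finset (Finset S)) (hQcov : ∀ s, ∃ q ∈ Q, s ∈ q)
    (hQdisj : ∀ q ∈ Q, ∀ q' ∈ Q, q ≠ q' → Disjoint q q')
    (Qsa : ℝ → S → U → Finset (Finset S)) (hQsa : ∀ c s a, Qsa c s a ⊆ Q)
    (hcover : ∀ c s, s ≠ su → ∀ a, post f J c s a ⊆ ((Qsa c s a).biUnion id : Finset S))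
    (hmono : ∀ c c', c ≤ c' → ∀ s, s ≠ su → ∀ a, Qsa c s a ⊆ Qsa c' s a)
    -- the confidence parameters
    (β εc βc : ℝ) (hβ : β ∈ Set.Ioo 0 1) (hεc : εc ∈ Set.Ioo 0 1) (hβc : 0 < βc)
    (hN : 0 < N) (hNc : Real.log (1 / βc) / Real.log (1 / (1 - εc)) ≤ N)
    (α : ℝ) :
    -- the data sets whose learned abstraction has confidence loss at most `α`, but violate the claim
    Measure.pi (fun _ : Fin N => P)
      {ŵ | confidenceLoss su β βc (Qsa (radius ŵ)) ≤ α ∧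
        ¬ (let M : UMDP S U := abstraction f J su β εc ŵ (Qsa (radius ŵ))
           let L := labelOf X Rint lab
           let Mφ : UMDP (S × Z) U := M.product (absLabel J L) D
           let F : Set (S × Z) := acceptingStates S D
           M.WellPosed ∧
           ∀ σφ : S × Z → U, Mφ.IsOptimal F σφ → ∀ x ∈ X,
             Mφ.rdpValue F (J x, D.step D.start (absLabel J L (J x))) ≤
               satProb f P L φ (refineStrategy J L D σφ) x)}
      ≤ ENNReal.ofReal α := by
  classical
  have hfx : ∀ x a, Measurable (f x a) := fun x a =>
    (hf a).comp (measurable_const.prodMk measurable_id)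
  have hJf : ∀ x a, Measurable fun w => J (f x a w) := fun x a => hJm.comp (hfx x a)
  rcases Set.eq_empty_or_nonempty {c | confidenceLoss su β βc (Qsa c) ≤ α} with hC | hC
  · refine le_of_eq_of_le ?_ zero_le
    refine measure_mono_null (t := ∅) (fun ŵ hw => ?_) measure_empty
    exact Set.eq_empty_iff_forall_notMem.1 hC _ hw.1
  -- Conditioning on the learned radius is avoided by a union bound over the largest selection that
  -- is compatible with the confidence level.
  obtain ⟨c₀, hc₀, hmax⟩ := exists_largest_selection hmono hC
  refine (measure_mono ?_).trans ((measure_pi_abstraction_fails_le P hfx hJm su hβ hεc hβc hN hNc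
    (Qsa c₀)).trans (ENNReal.ofReal_le_ofReal hc₀))
  rintro ŵ ⟨hloss, hfail⟩
  by_contra hgood
  simp only [Set.mem_union, Set.mem_iUnion, Finset.mem_erase, Finset.mem_univ, and_true, not_or,
    not_exists, Set.mem_ofPred_eq, not_lt] at hgood
  obtain ⟨hrad, hbounds⟩ := hgood
  refine hfail ?_
  have hsub := hmax (radius ŵ) hloss
  have hΓ : ∀ x a, J x ≠ su →
      lawPMF P (hJf x a) ∈ (abstraction f J su β εc ŵ (Qsa (radius ŵ))).Γ (J x) a := by
    intro x a hx
    refine lawPMF_mem_abstraction P (hJf x a) hx (hcover _ _ hx a) hrad ?_ ?_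
    · exact fun s' hs' => (hbounds (J x) hx a trivial).1 s'
        (Finset.biUnion_subset_biUnion_of_subset_left _ (hsub _ hx a) hs')
    · exact fun q hq => (hbounds (J x) hx a trivial).2 q (hsub _ hx a hq)
  have hWP : (abstraction f J su β εc ŵ (Qsa (radius ŵ))).WellPosed := by
    intro s a
    by_cases hs : s = su
    · exact ⟨PMF.pure su, by simp [abstraction, hs]⟩
    · obtain ⟨x, rfl⟩ := hJs s
      exact ⟨_, hΓ x a hs⟩
  refine ⟨hWP, fun σφ hσ x _ => ?_⟩
  refine (hσ.rdpValue_le hWP.product _).trans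
    (rdpValue_induced_le_satProb P hf hJm (absLabel_labelOf hsu hJR) hφ hD ?_ hWP hJf hΓ σφ x)
  intro x hx
  have hxX : x ∈ Xᶜ := hsu ▸ (show x ∈ J ⁻¹' {su} from hx)
  exact ⟨Xᶜ, Set.mem_insert _ _, hxX, hUnsafe⟩
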